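/- Let $p$ be a prime and $G$ a finite group. Write $|G|_{p'}=|G|/|G|_p$, where $|G|_p$ is the highest power of $p$ dividing $|G|$. Let $\mathcal{O}_G^*$ be the finite category whose objects are the nonidentity $p$-subgroups of $G$ and whose morphism sets are $$\mathcal{O}_G^*(H,K)=N_G(H,K)/K,\qquad N_G(H,K)=\{g\in G \mid g^{-1}Hg\le K\},$$ with composition induced from the multiplication of $G$. A finite category $\mathcal{C}$ has Euler characteristic if there are functions $k^\bullet,k_\bullet\colon \mathrm{Ob}(\mathcal{C})\to\mathbf{Q}$ (a weighting and a coweighting) with $\sum_{b}|\mathcal{C}(a,b)|\,k^b=1$ for every object $a$ and $\sum_{a}k_a\,|\mathcal{C}(a,b)|=1$ for every object $b$; its Euler characteristic is then $\chi(\mathcal{C})=\sum_b k^b=\sum_a k_a$, which does not depend on the choices. Then $\mathcal{O}_G^*$ has Euler characteristic, and $|G|_{p'}\,\chi(\mathcal{O}_G^*)$ is an integer. -/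

import Mathlib

open CategoryTheory

noncomputable section

/-! ### The Euler characteristic of a square matrix -/

section MatrixEuler

variable {S : Type*} [Fintype S]

/-- A weighting for `ζ`: a column vector `k` with `ζ k = (1, …, 1)`. -/
def IsWeighting (ζ : Matrix S S ℚ) (k : S → ℚ) : Prop :=
  ∀ a, ∑ b, ζ a b * k b = 1

/-- A coweighting for `ζ`: a row vector `k` with `k ζ = (1, …, 1)`. -/
def IsCoweighting (ζ : Matrix S S ℚ) (k : S → ℚ) : Prop :=
  ∀ b, ∑ a, k a * ζ a b = 1

/-- `ζ` has Euler characteristic if it admits both a weighting and a coweighting. -/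
def Matrix.HasEulerChar (ζ : Matrix S S ℚ) : Prop :=
  (∃ k, IsWeighting ζ k) ∧ (∃ k, IsCoweighting ζ k)

theorem IsWeighting.sum_eq {ζ : Matrix S S ℚ} {k l : S → ℚ}
    (hk : IsWeighting ζ k) (hl : IsCoweighting ζ l) : ∑ b, k b = ∑ a, l a := by
  calc ∑ b, k b = ∑ b, (∑ a, l a * ζ a b) * k b := by
        refine Finset.sum_congr rfl fun b _ => ?_
        rw [hl b, one_mul]
    _ = ∑ a, l a * ∑ b, ζ a b * k b := by
        simp_rw [Finset.sum_mul, Finset.mul_sum, mul_assoc]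
        exact Finset.sum_comm
    _ = ∑ a, l a := by
        refine Finset.sum_congr rfl fun a _ => ?_
        rw [hk a, mul_one]

open Classical in
/-- The Euler characteristic of `ζ`: the sum of the values of a weighting (by the two theorems
below, of any weighting, and of any coweighting); it is only meaningful if `ζ` has Euler
characteristic. -/
def Matrix.eulerChar (ζ : Matrix S S ℚ) : ℚ :=
  if h : ζ.HasEulerChar then ∑ b, h.1.choose b else 0

theorem Matrix.HasEulerChar.eulerChar_eq_sum_coweighting {ζ : Matrix S S ℚ}
    (h : ζ.HasEulerChar) {l : S → ℚ} (hl : IsCoweighting ζ l) :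
    ζ.eulerChar = ∑ a, l a := by
  rw [Matrix.eulerChar, dif_pos h]
  exact h.1.choose_spec.sum_eq hl

theorem Matrix.HasEulerChar.eulerChar_eq_sum_weighting {ζ : Matrix S S ℚ}
    (h : ζ.HasEulerChar) {k : S → ℚ} (hk : IsWeighting ζ k) :
    ζ.eulerChar = ∑ b, k b := by
  obtain ⟨l, hl⟩ := h.2
  rw [h.eulerChar_eq_sum_coweighting hl, hk.sum_eq hl]

end MatrixEuler

/-! ### The Euler characteristic of a finite category -/

section CategoryEuler

variable (C : Type*) [SmallCategory C] [FinCategory C]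

/-- The matrix counting the morphisms between pairs of objects of a finite category. -/
def zetaMatrix : Matrix C C ℚ := fun a b => (Nat.card (a ⟶ b) : ℚ)

/-- A finite category has Euler characteristic if its `ζ`-matrix does. -/
def HasEulerChar : Prop := (zetaMatrix C).HasEulerChar

/-- The Euler characteristic of a finite category. -/
def eulerChar : ℚ := (zetaMatrix C).eulerChar

end CategoryEuler

/-! ### The orbit category of `p`-subgroups -/

section Orbit

/-- The objects of the orbit category of `G` at `p`: all `p`-subgroups of `G`. -/
@[ext]
structure OrbitCategory (p : ℕ) (G : Type*) [Group G] where
  /-- the underlying subgroup -/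
  subgroup : Subgroup G
  /-- it is a `p`-subgroup -/
  isPGroup : IsPGroup p subgroup

/-- The transporter set `N_G(H,K) = {g ∈ G | H ^ g ≤ K}`, where `H ^ g = g⁻¹ H g`. -/
def transporterSet {G : Type*} [Group G] (H K : Subgroup G) : Set G :=
  {g | ∀ h ∈ H, g⁻¹ * h * g ∈ K}

/-- `g` and `g'` in `N_G(H,K)` are identified if `g K = g' K`. -/
def transporterSetoid {G : Type*} [Group G] (H K : Subgroup G) :
    Setoid (transporterSet H K) where
  r g g' := (g : G)⁻¹ * (g' : G) ∈ K
  iseqv :=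
    { refl := fun g => by simp
      symm := fun {g g'} h => by simpa using K.inv_mem h
      trans := fun {a b c} h h' => by simpa [mul_assoc] using K.mul_mem h h' }

variable {p : ℕ} {G : Type*} [Group G]

theorem one_mem_transporterSet (H : Subgroup G) : (1 : G) ∈ transporterSet H H :=
  fun h hh => by simpa using hh

theorem mul_mem_transporterSet {H K L : Subgroup G} {g g' : G}
    (hg : g ∈ transporterSet H K) (hg' : g' ∈ transporterSet K L) :
    g * g' ∈ transporterSet H L := fun h hh => by
  simpa [mul_assoc] using hg' _ (hg h hh)

/-- The morphisms from `H` to `K` are the elements of `N_G(H,K)/K`, and composition is induced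
from the multiplication of `G` (in diagrammatic order: `gK ≫ g'L = gg'L`). -/
instance OrbitCategory.category : Category (OrbitCategory p G) where
  Hom H K := Quotient (transporterSetoid H.subgroup K.subgroup)
  id H := Quotient.mk _ ⟨1, one_mem_transporterSet H.subgroup⟩
  comp {H K L} := Quotient.map₂
    (fun g g' => ⟨g * g', mul_mem_transporterSet g.2 g'.2⟩)
    (fun a a' (ha : (a : G)⁻¹ * (a' : G) ∈ K.subgroup) b b'
        (hb : (b : G)⁻¹ * (b' : G) ∈ L.subgroup) => by
      change ((a : G) * b)⁻¹ * ((a' : G) * b') ∈ L.subgroup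
      simpa [mul_assoc] using L.subgroup.mul_mem (b.2 _ ha) hb)
  id_comp {H K} f := by
    induction f using Quotient.inductionOn with
    | h g => exact congrArg (Quotient.mk _) (Subtype.ext (one_mul _))
  comp_id {H K} f := by
    induction f using Quotient.inductionOn with
    | h g => exact congrArg (Quotient.mk _) (Subtype.ext (mul_one _))
  assoc {H K L M} f g h := by
    induction f using Quotient.inductionOn with
    | h a =>
      induction g using Quotient.inductionOn with
      | h b =>
        induction h using Quotient.inductionOn with
        | h c => exact congrArg (Quotient.mk _) (Subtype.ext (mul_assoc _ _ _))

instance OrbitCategory.finite [Finite G] : Finite (OrbitCategory p G) :=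
  Finite.of_injective OrbitCategory.subgroup fun _ _ h => OrbitCategory.ext h

instance OrbitCategory.finite_hom [Finite G] (H K : OrbitCategory p G) : Finite (H ⟶ K) :=
  inferInstanceAs (Finite (Quotient (transporterSetoid H.subgroup K.subgroup)))

variable (p G)

/-- The full subcategory of the orbit category on the nonidentity `p`-subgroups. -/
abbrev NonidentityOrbitCategory : Type _ :=
  ObjectProperty.FullSubcategory fun H : OrbitCategory p G => H.subgroup ≠ ⊥

instance NonidentityOrbitCategory.finCategory [Finite G] :
    FinCategory (NonidentityOrbitCategory p G) where
  fintypeObj :=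
    haveI : Finite (NonidentityOrbitCategory p G) :=
      Finite.of_injective (fun X => X.obj) fun _ _ h => ObjectProperty.FullSubcategory.ext h
    Fintype.ofFinite _
  fintypeHom X Y :=
    haveI : Finite (X ⟶ Y) :=
      Finite.of_injective (fun f => f.hom) fun _ _ h => ObjectProperty.hom_ext _ h
    Fintype.ofFinite _

end Orbit

end

/-! Möbius inversion gives integers z_H with ∑_{H ≤ K} z_H = |K| for every nonidentity p-subgroup K.
Then z_H/|G| is a coweighting, so |G|_{p'} χ = (∑ z_H)/|G|_p, and it remains to show that |G|_p
divides ∑ z_H. If G acts on a finite set X with p-groups as stabilizers, then counting the pairs (H,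
x) with H fixing x gives ∑ z_H |X^H| = ∑ |G_x| over the x with G_x ≠ 1, which is |G| times the
number of nonfree orbits (`card_dvd_sum_mul_card_fixedPoints`). Take X = (G/P)^m with P Sylow and m
= φ(|G|_p). Since |(G/P)^H| is prime to p, Euler's theorem gives |X^H| ≡ 1 mod |G|_p for all H, so ∑
z_H ≡ 0 (`pow_dvd_sum`). -/

open Classical in
/-- Functions on a finite poset can be written as sums over lower sets of integer functions. -/
theorem exists_sum_ite_le_eq {ι α : Type*} [Fintype ι] [PartialOrder α] {s : ι → α}
    (hs : Function.Injective s) (f : ι → ℤ) :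
    ∃ z : ι → ℤ, ∀ b, ∑ a, (if s a ≤ s b then z a else 0) = f b := by
  let _ : PartialOrder ι := PartialOrder.lift s hs
  -- The value at b is forced by the values strictly below b, without division, so it stays
  -- integral.
  let F : (b : ι) → ((a : ι) → a < b → ℤ) → ℤ :=
    fun b z => f b - ∑ a, if h : a < b then z a h else 0
  refine ⟨WellFoundedLT.fix F, fun b => ?_⟩
  have hb : WellFoundedLT.fix F b =
      f b - ∑ a, if a < b then WellFoundedLT.fix F a else 0 := by
    rw [WellFoundedLT.fix_eq]
    simp only [F, dite_eq_ite]
  have hsplit : ∀ a, (if s a ≤ s b then WellFoundedLT.fix F a else 0) =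
      (if a < b then WellFoundedLT.fix F a else 0) +
        (if a = b then WellFoundedLT.fix F a else 0) := by
    intro a
    change (if a ≤ b then _ else _) = _
    rcases eq_or_ne a b with rfl | hab
    · simp
    · simp [hab, lt_iff_le_and_ne]
  rw [Finset.sum_congr rfl fun a _ => hsplit a, Finset.sum_add_distrib, Finset.sum_ite_eq']
  simp only [Finset.mem_univ, if_true]
  omega

/-! ### Counting transporters -/

section TransporterCount

variable {G : Type*} [Group G]

/-- The transporter set is a union of cosets of its target. -/
noncomputable def transporterEquiv (H K : Subgroup G) :
    transporterSet H K ≃ Quotient (transporterSetoid H K) × K where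
  toFun g := (Quotient.mk _ g,
    ⟨((Quotient.mk (transporterSetoid H K) g).out : G)⁻¹ * g, Quotient.exact (Quotient.out_eq (Quotient.mk (transporterSetoid H K) g))⟩)
  invFun q := ⟨(q.1.out : G) * q.2, mul_mem_transporterSet q.1.out.2
    fun h hh => K.mul_mem (K.mul_mem (K.inv_mem q.2.2) hh) q.2.2⟩
  left_inv g := Subtype.ext (by simp)
  right_inv q := by
    obtain ⟨q, k⟩ := q
    have hq : Quotient.mk (transporterSetoid H K) ⟨(q.out : G) * k,
        mul_mem_transporterSet q.out.2
          fun h hh => K.mul_mem (K.mul_mem (K.inv_mem k.2) hh) k.2⟩ = q := by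
      conv_rhs => rw [← q.out_eq]
      refine Quotient.sound ?_
      change ((q.out : G) * k)⁻¹ * (q.out : G) ∈ K
      simp
    refine Prod.ext hq (Subtype.ext ?_)
    change (((Quotient.mk (transporterSetoid H K) _).out : transporterSet H K) : G)⁻¹ * _ = _
    rw [hq]
    simp

theorem card_quotient_transporterSetoid_mul (H K : Subgroup G) :
    Nat.card (Quotient (transporterSetoid H K)) * Nat.card K =
      Nat.card (transporterSet H K) := by
  rw [Nat.card_congr (transporterEquiv H K), Nat.card_prod]

open Classical in
theorem card_transporterSet_eq_sum [Fintype G] (H K : Subgroup G) :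
    (Nat.card (transporterSet H K) : ℚ) =
      ∑ g : G, if g ∈ transporterSet H K then 1 else 0 := by
  rw [Finset.sum_boole, Nat.card_eq_fintype_card, Fintype.card_subtype]

/-- Conjugation moves to the target here and to the source in the next lemma: a coweighting sums
over sources, a weighting over targets, and the summed subgroup must stay unconjugated. -/
theorem mem_transporterSet_iff_le_map (H K : Subgroup G) (g : G) :
    g ∈ transporterSet H K ↔ H ≤ K.map (MulAut.conj g).toMonoidHom := by
  refine forall₂_congr fun h _ => ?_
  rw [Subgroup.mem_map_equiv]
  simp [MulAut.conj_symm_apply]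

theorem mem_transporterSet_iff_map_le (H K : Subgroup G) (g : G) :
    g ∈ transporterSet H K ↔ H.map (MulAut.conj g⁻¹).toMonoidHom ≤ K := by
  rw [Subgroup.map_le_iff_le_comap]
  refine forall₂_congr fun h _ => ?_
  simp

end TransporterCount

/-! ### Weightings, coweightings and fixed points -/

namespace NonidentityOrbitCategory

variable {p : ℕ} {G : Type*} [Group G]

/-- A nonidentity `p`-subgroup as an object of the orbit category. -/
def mk' (H : Subgroup G) (hp : IsPGroup p H) (h : H ≠ ⊥) : NonidentityOrbitCategory p G :=
  ⟨⟨H, hp⟩, h⟩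

/-- The `p`-subgroup underlying an object. -/
def toSubgroup (H : NonidentityOrbitCategory p G) : Subgroup G := H.obj.subgroup

theorem toSubgroup_injective :
    Function.Injective (toSubgroup : NonidentityOrbitCategory p G → Subgroup G) :=
  fun _ _ h => ObjectProperty.FullSubcategory.ext (OrbitCategory.ext h)

/-- The conjugate `g H g⁻¹` of an object. -/
def conj (H : NonidentityOrbitCategory p G) (g : G) : NonidentityOrbitCategory p G :=
  mk' (H.toSubgroup.map (MulAut.conj g).toMonoidHom) (H.obj.isPGroup.map _) fun h =>
    H.property ((Subgroup.map_eq_bot_iff_of_injective _ (MulAut.conj g).injective).1 h)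

theorem toSubgroup_conj (H : NonidentityOrbitCategory p G) (g : G) :
    (H.conj g).toSubgroup = H.toSubgroup.map (MulAut.conj g).toMonoidHom :=
  rfl

theorem card_conj (H : NonidentityOrbitCategory p G) (g : G) :
    Nat.card (H.conj g).toSubgroup = Nat.card H.toSubgroup :=
  Subgroup.card_map_of_injective (MulAut.conj g).injective

theorem zetaMatrix_mul_card [Finite G] (H K : NonidentityOrbitCategory p G) :
    zetaMatrix (NonidentityOrbitCategory p G) H K * Nat.card K.toSubgroup =
      Nat.card (transporterSet H.toSubgroup K.toSubgroup) := by
  have e : (H ⟶ K) ≃ Quotient (transporterSetoid H.toSubgroup K.toSubgroup) :=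
    ⟨fun f => f.hom, fun f => ⟨f⟩, fun _ => rfl, fun _ => rfl⟩
  rw [zetaMatrix, Nat.card_congr e, ← card_quotient_transporterSetoid_mul]
  push_cast
  rfl

variable [Finite G]

-- The factor |K| turns |N_G(H,K)/K| into |N_G(H,K)|, a count of the g with H^g ≤ K. For each g the
-- sum over K is 1, because H^g is again an object.
open Classical in
theorem isWeighting_of_sum_ge {w : NonidentityOrbitCategory p G → ℤ}
    (hw : ∀ H : NonidentityOrbitCategory p G,
      ∑ K, (if H.toSubgroup ≤ K.toSubgroup then w K else 0) = 1) :
    IsWeighting (zetaMatrix (NonidentityOrbitCategory p G))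
      fun K => Nat.card K.toSubgroup * w K / Nat.card G := by
  intro H
  have := Fintype.ofFinite G
  have hG : (Nat.card G : ℚ) ≠ 0 := Nat.cast_ne_zero.2 Nat.card_pos.ne'
  have hterm (K : NonidentityOrbitCategory p G) :
      zetaMatrix _ H K * (Nat.card K.toSubgroup * w K / Nat.card G) =
        (∑ g : G, ((if (H.conj g⁻¹).toSubgroup ≤ K.toSubgroup then w K else 0 : ℤ) : ℚ)) /
          Nat.card G := by
    rw [← mul_div_assoc, ← mul_assoc, zetaMatrix_mul_card, card_transporterSet_eq_sum,
      Finset.sum_mul]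
    refine congrArg (· / _) (Finset.sum_congr rfl fun g _ => ?_)
    simp only [mem_transporterSet_iff_map_le]
    rw [toSubgroup_conj, apply_ite (Int.cast : ℤ → ℚ), Int.cast_zero, ite_mul, one_mul, zero_mul]
  rw [Finset.sum_congr rfl fun K _ => hterm K, ← Finset.sum_div, Finset.sum_comm]
  simp_rw [← Int.cast_sum, hw]
  simp only [Finset.sum_const, Finset.card_univ, nsmul_eq_mul, mul_one,
    ← Nat.card_eq_fintype_card]
  exact div_self hG

-- For each g, the sum of z_H over H ≤ gKg⁻¹ is |gKg⁻¹| = |K|, which cancels the |K| in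
-- |N_G(H,K)|/|K|.
open Classical in
theorem isCoweighting_of_sum_le {z : NonidentityOrbitCategory p G → ℤ}
    (hz : ∀ K : NonidentityOrbitCategory p G,
      ∑ H, (if H.toSubgroup ≤ K.toSubgroup then z H else 0) = Nat.card K.toSubgroup) :
    IsCoweighting (zetaMatrix (NonidentityOrbitCategory p G))
      fun H => z H / Nat.card G := by
  intro K
  have := Fintype.ofFinite G
  have hG : (Nat.card G : ℚ) ≠ 0 := Nat.cast_ne_zero.2 Nat.card_pos.ne'
  have hK : (Nat.card K.toSubgroup : ℚ) ≠ 0 := Nat.cast_ne_zero.2 Nat.card_pos.ne'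
  have hterm (H : NonidentityOrbitCategory p G) :
      z H / Nat.card G * zetaMatrix _ H K =
        (∑ g : G, ((if H.toSubgroup ≤ (K.conj g).toSubgroup then z H else 0 : ℤ) : ℚ)) /
          (Nat.card G * Nat.card K.toSubgroup) := by
    rw [eq_div_iff (mul_ne_zero hG hK)]
    have : (z H : ℚ) / Nat.card G * zetaMatrix _ H K * (Nat.card G * Nat.card K.toSubgroup) =
        (zetaMatrix _ H K * Nat.card K.toSubgroup) * z H := by
      field_simp
    rw [this, zetaMatrix_mul_card, card_transporterSet_eq_sum, Finset.sum_mul]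
    refine Finset.sum_congr rfl fun g _ => ?_
    simp only [mem_transporterSet_iff_le_map]
    rw [toSubgroup_conj, apply_ite (Int.cast : ℤ → ℚ), Int.cast_zero, ite_mul, one_mul, zero_mul]
  rw [Finset.sum_congr rfl fun H _ => hterm H, ← Finset.sum_div, Finset.sum_comm]
  simp_rw [← Int.cast_sum, hz, card_conj]
  simp only [Finset.sum_const, Finset.card_univ, nsmul_eq_mul,
    ← Nat.card_eq_fintype_card]
  push_cast
  exact div_self (mul_ne_zero hG hK)

theorem exists_isWeighting :
    ∃ k, IsWeighting (zetaMatrix (NonidentityOrbitCategory p G)) k := by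
  -- The dual order turns sums over lower sets into sums over upper sets.
  obtain ⟨w, hw⟩ := exists_sum_ite_le_eq
    (s := fun H : NonidentityOrbitCategory p G => OrderDual.toDual H.toSubgroup)
    (OrderDual.toDual.injective.comp toSubgroup_injective) 1
  exact ⟨_, isWeighting_of_sum_ge hw⟩

open Classical in
/-- The fixed points of the nonidentity `p`-subgroups detect the number of nonfree orbits of an
action whose stabilizers are `p`-groups. -/
theorem card_dvd_sum_mul_card_fixedPoints {z : NonidentityOrbitCategory p G → ℤ}
    (hz : ∀ K : NonidentityOrbitCategory p G,
      ∑ H, (if H.toSubgroup ≤ K.toSubgroup then z H else 0) = Nat.card K.toSubgroup)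
    (X : Type*) [Finite X] [MulAction G X]
    (hX : ∀ x : X, IsPGroup p (MulAction.stabilizer G x)) :
    (Nat.card G : ℤ) ∣
      ∑ H : NonidentityOrbitCategory p G, z H * Nat.card (MulAction.fixedPoints H.toSubgroup X) := by
  have := Fintype.ofFinite X
  have hfix (H : NonidentityOrbitCategory p G) :
      z H * (Nat.card (MulAction.fixedPoints H.toSubgroup X) : ℤ) =
        ∑ x : X, if H.toSubgroup ≤ MulAction.stabilizer G x then z H else 0 := by
    have hmem (x : X) : H.toSubgroup ≤ MulAction.stabilizer G x ↔
        x ∈ MulAction.fixedPoints H.toSubgroup X :=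
      ⟨fun h g => h g.2, fun h g hg => h ⟨g, hg⟩⟩
    rw [Nat.card_eq_fintype_card, Fintype.card_subtype]
    simp only [hmem]
    rw [← Finset.sum_filter, Finset.sum_const, nsmul_eq_mul, mul_comm]
  have hsum (x : X) :
      (∑ H : NonidentityOrbitCategory p G,
        if H.toSubgroup ≤ MulAction.stabilizer G x then z H else 0) =
      if MulAction.stabilizer G x = ⊥ then 0 else (Nat.card (MulAction.stabilizer G x) : ℤ) := by
    split_ifs with h
    -- A point with trivial stabilizer is fixed by no nonidentity subgroup.
    · refine Finset.sum_eq_zero fun H _ => if_neg fun hH => H.property ?_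
      rw [h] at hH
      exact le_bot_iff.1 hH
    · exact hz (mk' _ (hX x) h)
  rw [Finset.sum_congr rfl fun H _ => hfix H, Finset.sum_comm, Finset.sum_congr rfl fun x _ => hsum x,
    ← Finset.sum_fiberwise Finset.univ (fun x => (Quotient.mk (MulAction.orbitRel G X) x))]
  refine Finset.dvd_sum fun ω _ => ?_
  induction ω using Quotient.inductionOn with
  | h x =>
    -- Stabilizers along an orbit are isomorphic, so the summand is constant there and a nonfree
    -- orbit contributes |orbit| · |stabilizer| = |G|.
    have hstab (y : X) (hy : y ∈ MulAction.orbit G x) :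
        (if MulAction.stabilizer G y = ⊥ then 0 else (Nat.card (MulAction.stabilizer G y) : ℤ)) =
        if MulAction.stabilizer G x = ⊥ then 0 else (Nat.card (MulAction.stabilizer G x) : ℤ) := by
      have hcard : Nat.card (MulAction.stabilizer G y) = Nat.card (MulAction.stabilizer G x) :=
        Nat.card_congr (MulAction.stabilizerEquivStabilizerOfOrbitRel hy).toEquiv
      rw [← Subgroup.card_eq_one, ← Subgroup.card_eq_one, hcard]
    have hmem (y : X) : Quotient.mk (MulAction.orbitRel G X) y = Quotient.mk _ x ↔
        y ∈ MulAction.orbit G x := Quotient.eq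
    simp only [hmem]
    rw [Finset.sum_congr rfl fun y hy => hstab y (Finset.mem_filter.1 hy).2, Finset.sum_const,
      nsmul_eq_mul]
    split_ifs
    · simp
    · have := Fintype.ofFinite G
      refine dvd_of_eq ?_
      rw [← Fintype.card_subtype, Nat.card_eq_fintype_card, Nat.card_eq_fintype_card]
      exact_mod_cast (MulAction.card_orbit_mul_card_stabilizer_eq_card_group G x).symm

end NonidentityOrbitCategory

/-! ### Powers of G/P and the integrality of the Euler characteristic -/

/-- A p-group acting on G/P has |G : P| fixed points modulo p, and this index is prime to p. -/
theorem Sylow.not_dvd_card_fixedPoints_quotient {p : ℕ} [Fact p.Prime] {G : Type*} [Group G]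
    [Finite G] (P : Sylow p G) {H : Subgroup G} (hH : IsPGroup p H) :
    ¬ p ∣ Nat.card (MulAction.fixedPoints H (G ⧸ (P : Subgroup G))) := by
  have h := hH.card_modEq_card_fixedPoints (G ⧸ (P : Subgroup G))
  rw [← (h.dvd_iff dvd_rfl)]
  exact P.not_dvd_index

/-- Fixed points of a diagonal action on tuples. -/
theorem card_fixedPoints_pi (H : Type*) [Group H] (m : ℕ) (Y : Type*) [MulAction H Y] :
    Nat.card (MulAction.fixedPoints H (Fin m → Y)) = Nat.card (MulAction.fixedPoints H Y) ^ m := by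
  let e : MulAction.fixedPoints H (Fin m → Y) ≃ (Fin m → MulAction.fixedPoints H Y) :=
    { toFun := fun f i => ⟨f.1 i, fun h => congrFun (f.2 h) i⟩
      invFun := fun f => ⟨fun i => f i, fun h => funext fun i => (f i).2 h⟩
      left_inv := fun _ => rfl
      right_inv := fun _ => rfl }
  rw [Nat.card_congr e, Nat.card_fun, Nat.card_fin]

/-- The stabilizer lies in that of the first coordinate, a conjugate of P. The empty tuple must be
excluded, as all of G fixes it. -/
theorem Sylow.isPGroup_stabilizer_tuple {p : ℕ} {G : Type*} [Group G] (P : Sylow p G) {m : ℕ}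
    (hm : 0 < m) (f : Fin m → G ⧸ (P : Subgroup G)) :
    IsPGroup p (MulAction.stabilizer G f) := by
  have hle : MulAction.stabilizer G f ≤ MulAction.stabilizer G (f ⟨0, hm⟩) :=
    fun g hg => congrFun hg ⟨0, hm⟩
  refine IsPGroup.to_le ?_ hle
  induction f ⟨0, hm⟩ using QuotientGroup.induction_on with
  | H g =>
    have h1 : ((g : G) : G ⧸ (P : Subgroup G)) = g • ((1 : G) : G ⧸ (P : Subgroup G)) := by
      rw [MulAction.Quotient.smul_coe, smul_eq_mul, mul_one]
    rw [h1, MulAction.stabilizer_smul_eq_stabilizer_map_conj, MulAction.stabilizer_quotient]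
    exact P.isPGroup'.map _

open Classical in
/-- The sum of the coweights, multiplied by `|G|`, is divisible by the `p`-part of `|G|`: compare
it with the number of nonfree orbits on a suitable power of `G / P`, for a Sylow subgroup `P`. -/
theorem NonidentityOrbitCategory.pow_dvd_sum {p : ℕ} [Fact p.Prime] {G : Type*} [Group G]
    [Finite G] {z : NonidentityOrbitCategory p G → ℤ}
    (hz : ∀ K : NonidentityOrbitCategory p G,
      ∑ H, (if H.toSubgroup ≤ K.toSubgroup then z H else 0) = Nat.card K.toSubgroup)
    {n : ℕ} (hn : p ^ n ∣ Nat.card G) :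
    ((p ^ n : ℕ) : ℤ) ∣ ∑ H, z H := by
  obtain ⟨P⟩ : Nonempty (Sylow p G) := inferInstance
  obtain ⟨m, hm⟩ : ∃ m, (p ^ n).totient = m := ⟨_, rfl⟩
  have hm0 : 0 < m := hm ▸ Nat.totient_pos.2 (pow_pos (Fact.out : p.Prime).pos _)
  have hdvd := (Int.natCast_dvd_natCast.2 hn).trans
    (card_dvd_sum_mul_card_fixedPoints hz (Fin m → G ⧸ (P : Subgroup G))
      (P.isPGroup_stabilizer_tuple hm0))
  -- It suffices that ∑ z_H |X^H| and ∑ z_H agree modulo p^n, which holds termwise by Euler's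
  -- theorem.
  refine (dvd_iff_dvd_of_dvd_sub ?_).1 hdvd
  rw [← Finset.sum_sub_distrib]
  refine Finset.dvd_sum fun H _ => ?_
  have hpi : Nat.card (MulAction.fixedPoints H.toSubgroup (Fin m → G ⧸ (P : Subgroup G))) =
      Nat.card (MulAction.fixedPoints H.toSubgroup (G ⧸ (P : Subgroup G))) ^ m :=
    card_fixedPoints_pi H.toSubgroup m (G ⧸ (P : Subgroup G))
  rw [hpi, ← mul_sub_one]
  refine Dvd.dvd.mul_left ?_ _
  have hcop : (Nat.card (MulAction.fixedPoints H.toSubgroup (G ⧸ (P : Subgroup G)))).Coprime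
      (p ^ n) :=
    (((Fact.out : p.Prime).coprime_iff_not_dvd.2
      (P.not_dvd_card_fixedPoints_quotient H.obj.isPGroup)).pow_left _).symm
  have h := Nat.modEq_iff_dvd.1 (Nat.ModEq.pow_totient hcop).symm
  rw [hm] at h
  simpa only [Nat.cast_pow, Nat.cast_one] using h

theorem corollary4p5 (p : ℕ) [Fact p.Prime] (G : Type*) [Group G] [Finite G] :
    HasEulerChar (NonidentityOrbitCategory p G) ∧
      ∃ n : ℤ, ((ordCompl[p] (Nat.card G) : ℕ) : ℚ) *
        eulerChar (NonidentityOrbitCategory p G) = (n : ℚ) := by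
  obtain ⟨z, hz⟩ := exists_sum_ite_le_eq
    (NonidentityOrbitCategory.toSubgroup_injective (p := p) (G := G))
    fun K => (Nat.card K.toSubgroup : ℤ)
  have hco := NonidentityOrbitCategory.isCoweighting_of_sum_le hz
  have hE : HasEulerChar (NonidentityOrbitCategory p G) :=
    ⟨NonidentityOrbitCategory.exists_isWeighting, _, hco⟩
  refine ⟨hE, ?_⟩
  obtain ⟨n, hn⟩ := NonidentityOrbitCategory.pow_dvd_sum hz
    (Nat.ordProj_dvd (Nat.card G) p)
  refine ⟨n, ?_⟩
  have hG : (Nat.card G : ℚ) ≠ 0 := Nat.cast_ne_zero.2 Nat.card_pos.ne'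
  have hmul : (Nat.card G : ℚ) =
      (ordProj[p] (Nat.card G) : ℕ) * (ordCompl[p] (Nat.card G) : ℕ) := by
    exact_mod_cast (Nat.ordProj_mul_ordCompl_eq_self (Nat.card G) p).symm
  rw [eulerChar, Matrix.HasEulerChar.eulerChar_eq_sum_coweighting hE hco, ← Finset.sum_div,
    ← Int.cast_sum, hn, ← mul_div_assoc, div_eq_iff hG, hmul]
  push_cast
  ring
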